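/- Let $G$ be a connected, regular (simple, undirected) graph on the vertex set $[n]=\{1,\dots,n\}$ with $n\ge 6$, let $\sigma_W>0$ and $\lambda\in[0,1]$, and let $\mathbf W=(W_i)_{i\in[n]}$ be i.i.d. $\mathcal N(0,\sigma_W^2)$ random variables, i.e. $\mathbf W\sim\mathcal N(\mathbf 0,\sigma_W^2\mathbf I_n)$. Consider the continuous-time Markov chain on $[n]$ with transition rates $R_{ij}=\exp(\lambda W_i-(1-\lambda)W_j)$ for every edge $(i,j)$ of $G$, and $R_{ij}=0$ for all other $i\ne j$. Let $\boldsymbol\pi=(\pi_i)$ be its stationary distribution, let $q_i=\sum_{j\sim i}R_{ij}$ be its exit rates, and let $$\rho=\rho(\mathbf R)=\mathrm{Corr}(-\log\pi_I,\log q_I)=-\frac{\mathrm{Cov}(\log\pi_I,\log q_I)}{\sqrt{\mathrm{Var}(\log\pi_I)\,\mathrm{Var}(\log q_I)}},$$ where covariance and variances are taken, for fixed $\mathbf W$, over a uniformly random state $I\in[n]$. Then $\rho$ is almost surely well defined (the stationary distribution exists and is unique, and both variances are positive), and $$\mathbb E(\rho)\ \ge\ 1-16\left(1+O(n^{-1/2})\right)(1-\lambda)^2,$$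 where the error term is uniform in all parameters: there is a universal constant $C$, depending on none of $n$, $G$, $\sigma_W$, $\lambda$, such that $\mathbb E(\rho)\ge 1-16\,(1+C n^{-1/2})(1-\lambda)^2$ in every such case. In particular the bound holds uniformly in $\sigma_W$, hence at every temperature. -/

import Mathlib

open Real MeasureTheory ProbabilityTheory

/-! Finite-state continuous-time Markov chains are given by the matrix `Q` of their jump rates
`Q i j`, `i ≠ j`; the diagonal entries of `Q` play no role. -/

/-- The exit rate `q i = ∑ j ≠ i, Q i j` of state `i`. -/
noncomputable def exitRate {n : ℕ} (Q : Matrix (Fin n) (Fin n) ℝ) (i : Fin n) : ℝ :=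
  ∑ j ∈ Finset.univ.erase i, Q i j

/-- The infinitesimal generator: the jump rates off the diagonal, minus the exit rates on it. -/
noncomputable def generator {n : ℕ} (Q : Matrix (Fin n) (Fin n) ℝ) :
    Matrix (Fin n) (Fin n) ℝ :=
  fun i j => if i = j then -exitRate Q i else Q i j

/-- `p` is a stationary distribution: a probability vector annihilated by the generator. -/
def IsStationaryDist {n : ℕ} (Q : Matrix (Fin n) (Fin n) ℝ) (p : Fin n → ℝ) : Prop :=
  p ∈ stdSimplex ℝ (Fin n) ∧ Matrix.vecMul p (generator Q) = 0

open Classical in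
/-- The stationary distribution of `Q`, when there is exactly one (otherwise the value is `0`). -/
noncomputable def stationaryDist {n : ℕ} (Q : Matrix (Fin n) (Fin n) ℝ) : Fin n → ℝ :=
  if h : ∃! p : Fin n → ℝ, IsStationaryDist Q p then h.choose else 0

/-- The law of a uniformly random state. -/
noncomputable def unifState (n : ℕ) : Measure (Fin n) :=
  uniformOn Set.univ

/-- The log exit rates. -/
noncomputable def logExit {n : ℕ} (Q : Matrix (Fin n) (Fin n) ℝ) (i : Fin n) : ℝ :=
  log (exitRate Q i)

/-- The effective potential, minus the logarithm of the stationary distribution. -/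
noncomputable def effPotential {n : ℕ} (Q : Matrix (Fin n) (Fin n) ℝ) (i : Fin n) : ℝ :=
  -log (stationaryDist Q i)

/-- The correlation, over a uniformly random state, of effective potential and log exit rate. -/
noncomputable def rho {n : ℕ} (Q : Matrix (Fin n) (Fin n) ℝ) : ℝ :=
  cov[effPotential Q, logExit Q; unifState n] /
    √(Var[effPotential Q; unifState n] * Var[logExit Q; unifState n])

/-- The correlation `rho Q` is well defined: `Q` has a unique stationary distribution, it and the
exit rates have positive entries, and their logarithms have positive variance. -/
structure RhoWellDefined {n : ℕ} (Q : Matrix (Fin n) (Fin n) ℝ) : Prop where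
  existsUnique : ∃! p : Fin n → ℝ, IsStationaryDist Q p
  stationary_pos : ∀ i, 0 < stationaryDist Q i
  exitRate_pos : ∀ i, 0 < exitRate Q i
  var_effPotential_pos : 0 < Var[effPotential Q; unifState n]
  var_logExit_pos : 0 < Var[logExit Q; unifState n]

/-- The jump rates of the random energy model dynamics on `G` with locality parameter `lam` and
well depths `w`. -/
noncomputable def remRates {n : ℕ} (G : SimpleGraph (Fin n)) [DecidableRel G.Adj]
    (lam : ℝ) (w : Fin n → ℝ) : Matrix (Fin n) (Fin n) ℝ :=
  fun i j => if G.Adj i j then exp (lam * w i - (1 - lam) * w j) else 0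

/-! The rates satisfy detailed balance with weights `exp (-w i)`. Connectedness makes the normalised
weights the only stationary distribution, so up to an additive constant the effective potential is
`w`, while the log exit rate is `lam * w i + L i` with `L = logNbrSum G (1 - lam) w`. Hence `rho` is
the correlation of `w` with `lam * w + L`, and `one_sub_correlation_le` gives `1 - rho ≤ 2 Var L /
(lam² Var w)`.

The numerator is small on average: `L i` has gradient of norm at most `1 - lam`, so a Gaussian
Poincaré inequality, proved by rotating two independent copies into each other, bounds its variance
by `π² / 8 * σ² * (1 - lam)²`. In a regular graph all `L i` have the same mean, so the expected
empirical variance obeys the same bound (`integral_variance_logNbrSum_le`).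

The denominator is below `σ² / 2` only with exponentially small probability, by Chernoff bounds;
there the deterministic bound `Var L ≤ n (1 - lam)² / 2 * Var w` suffices. Together, `1 - E rho ≤ (1
- lam)² / lam² * (π² / 2 + n * P(bad))`. Every bound scales with `σ²`, hence the uniformity in `σ`.
If `lam` is far from `1`, the claim follows from `rho ≥ -1`; otherwise the constant 16 absorbs `π² /
(2 lam²)`.

Almost sure well-definedness holds because a coincidence of two potentials, or of the exit rates of
two neighbours, confines one coordinate to at most one value given the others. -/

/-! ### Stationary distributions of reversible chains -/

lemma vecMul_generator_apply {n : ℕ} (Q : Matrix (Fin n) (Fin n) ℝ) (p : Fin n → ℝ) (j : Fin n) :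
    Matrix.vecMul p (generator Q) j
      = ∑ i ∈ Finset.univ.erase j, (p i * Q i j - p j * Q j i) := by
  rw [Finset.sum_sub_distrib, ← Finset.mul_sum, Matrix.vecMul, dotProduct,
    ← Finset.sum_erase_add _ _ (Finset.mem_univ j)]
  have : ∑ i ∈ Finset.univ.erase j, p i * generator Q i j
      = ∑ i ∈ Finset.univ.erase j, p i * Q i j :=
    Finset.sum_congr rfl fun i hi => by simp [generator, Finset.ne_of_mem_erase hi]
  rw [this]
  simp only [generator, if_true, exitRate]
  ring

/-- If `b` satisfies detailed balance for `Q`, then `u * b` is annihilated by the generator only if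
`u` is constant along edges of positive flow. -/
lemma eq_of_vecMul_generator_eq_zero {n : ℕ} {Q : Matrix (Fin n) (Fin n) ℝ} {b u : Fin n → ℝ}
    (hQ : ∀ i j, 0 ≤ b i * Q i j) (hb : ∀ i j, b i * Q i j = b j * Q j i)
    (h : Matrix.vecMul (fun i => u i * b i) (generator Q) = 0) {i j : Fin n}
    (hij : 0 < b i * Q i j) : u i = u j := by
  have h1 : ∀ j, ∑ i, b i * Q i j * (u i - u j) = 0 := by
    intro j
    have := congrFun h j
    rw [vecMul_generator_apply, Pi.zero_apply] at this
    rw [← Finset.sum_erase_add _ _ (Finset.mem_univ j), sub_self, mul_zero, add_zero, ← this]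
    refine Finset.sum_congr rfl fun i _ => ?_
    linear_combination (-u j) * hb i j
  -- Testing stationarity against `u`, and symmetrising by detailed balance, makes the Dirichlet
  -- form of `u` vanish; each of its nonnegative terms is then zero.
  have h2 : ∑ j, ∑ i, b i * Q i j * (u i - u j) * u j = 0 := by
    simp_rw [← Finset.sum_mul, h1]; simp
  have h3 : ∑ j, ∑ i, b i * Q i j * (u i - u j) * u i = 0 := by
    rw [Finset.sum_comm, ← neg_eq_zero, ← h2, ← Finset.sum_neg_distrib]
    refine Finset.sum_congr rfl fun i _ => ?_
    rw [← Finset.sum_neg_distrib]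
    refine Finset.sum_congr rfl fun j _ => ?_
    linear_combination (u j - u i) * u i * hb i j
  have h4 : ∑ j, ∑ i, b i * Q i j * (u i - u j) ^ 2 = 0 := by
    have := congrArg₂ (· - ·) h3 h2
    simp only [← Finset.sum_sub_distrib, sub_zero] at this
    rw [← this]
    exact Finset.sum_congr rfl fun j _ => Finset.sum_congr rfl fun i _ => by ring
  have hnn : ∀ j i, 0 ≤ b i * Q i j * (u i - u j) ^ 2 :=
    fun j i => mul_nonneg (hQ i j) (sq_nonneg _)
  have h5 := (Finset.sum_eq_zero_iff_of_nonneg fun j _ => Finset.sum_nonneg fun i _ => hnn j i).1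
    h4 j (Finset.mem_univ j)
  have h6 := (Finset.sum_eq_zero_iff_of_nonneg fun i _ => hnn j i).1 h5 i (Finset.mem_univ i)
  have := (mul_eq_zero.1 h6).resolve_left hij.ne'
  exact sub_eq_zero.1 (pow_eq_zero_iff two_ne_zero |>.1 this)

/-- A reversible chain that is irreducible along a connected graph has exactly one stationary
distribution, the reversible one. -/
lemma isStationaryDist_iff_of_reversible {n : ℕ} {Q : Matrix (Fin n) (Fin n) ℝ} {b : Fin n → ℝ}
    {G : SimpleGraph (Fin n)} (hG : G.Connected) (hpos : ∀ i, 0 < b i) (hsum : ∑ i, b i = 1)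
    (hQ : ∀ i j, 0 ≤ Q i j) (hadj : ∀ i j, G.Adj i j → 0 < Q i j)
    (hb : ∀ i j, b i * Q i j = b j * Q j i) (p : Fin n → ℝ) :
    IsStationaryDist Q p ↔ p = b := by
  constructor
  · rintro ⟨hp, hp0⟩
    set u : Fin n → ℝ := fun i => p i / b i with hu
    have hub : (fun i => u i * b i) = p := by
      funext i; simp [hu, (hpos i).ne']
    have hstep : ∀ i j, G.Adj i j → u i = u j := fun i j hij =>
      eq_of_vecMul_generator_eq_zero (fun i j => mul_nonneg (hpos i).le (hQ i j)) hb
        (by rw [hub]; exact hp0) (mul_pos (hpos i) (hadj i j hij))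
    have hconst : ∀ i j, u i = u j := by
      intro i j
      obtain ⟨w⟩ := hG.preconnected i j
      induction w with
      | nil => rfl
      | cons h _ ih => exact (hstep _ _ h).trans ih
    obtain ⟨i₀⟩ := hG.nonempty
    have hui : u i₀ = 1 := by
      have h1 : ∑ i, p i = 1 := hp.2
      rw [← hub] at h1
      simp_rw [fun i => hconst i i₀, ← Finset.mul_sum, hsum, mul_one] at h1
      exact h1
    rw [← hub]
    funext i
    rw [hconst i i₀, hui, one_mul]
  · rintro rfl
    refine ⟨⟨fun i => (hpos i).le, hsum⟩, ?_⟩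
    funext j
    rw [vecMul_generator_apply]
    exact Finset.sum_eq_zero fun i _ => by rw [hb i j, sub_self]

lemma stationaryDist_eq_of_iff {n : ℕ} {Q : Matrix (Fin n) (Fin n) ℝ} {b : Fin n → ℝ}
    (h : ∀ p, IsStationaryDist Q p ↔ p = b) : stationaryDist Q = b := by
  have hex : ∃! p : Fin n → ℝ, IsStationaryDist Q p := ⟨b, (h b).2 rfl, fun p hp => (h p).1 hp⟩
  rw [stationaryDist, dif_pos hex]
  exact (h _).1 hex.choose_spec.1

/-! ### The random energy model dynamics -/

section REM

variable {n : ℕ} (G : SimpleGraph (Fin n)) [DecidableRel G.Adj]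

/-- The logarithm of the sum of `exp (-ε * w j)` over the neighbours `j` of a vertex. -/
noncomputable def logNbrSum (ε : ℝ) (w : Fin n → ℝ) (i : Fin n) : ℝ :=
  log (∑ j ∈ G.neighborFinset i, exp (-ε * w j))

variable {G}

lemma isStationaryDist_remRates_iff (hG : G.Connected) (lam : ℝ) (w p : Fin n → ℝ) :
    IsStationaryDist (remRates G lam w) p ↔ p = fun i => exp (-w i) / ∑ k, exp (-w k) := by
  have : Nonempty (Fin n) := hG.nonempty
  have hZ : 0 < ∑ k, exp (-w k) := Finset.sum_pos (fun k _ => exp_pos _) Finset.univ_nonempty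
  refine isStationaryDist_iff_of_reversible hG (fun i => div_pos (exp_pos _) hZ) ?_ ?_ ?_ ?_ p
  · rw [← Finset.sum_div, div_self hZ.ne']
  · intro i j
    unfold remRates
    split_ifs
    · positivity
    · rfl
  · intro i j hij
    simp only [remRates, hij, if_true]
    positivity
  · intro i j
    by_cases hij : G.Adj i j
    · simp only [remRates, hij, hij.symm, if_true, div_mul_eq_mul_div, ← exp_add]
      congr 2
      ring
    · have hji : ¬ G.Adj j i := fun h => hij h.symm
      simp [remRates, hij, hji]

lemma stationaryDist_remRates (hG : G.Connected) (lam : ℝ) (w : Fin n → ℝ) :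
    stationaryDist (remRates G lam w) = fun i => exp (-w i) / ∑ k, exp (-w k) :=
  stationaryDist_eq_of_iff (isStationaryDist_remRates_iff hG lam w)

lemma effPotential_remRates (hG : G.Connected) (lam : ℝ) (w : Fin n → ℝ) :
    effPotential (remRates G lam w) = fun i => w i + log (∑ k, exp (-w k)) := by
  have : Nonempty (Fin n) := hG.nonempty
  have hZ : 0 < ∑ k, exp (-w k) := Finset.sum_pos (fun k _ => exp_pos _) Finset.univ_nonempty
  funext i
  rw [effPotential, stationaryDist_remRates hG, log_div (exp_ne_zero _) hZ.ne', log_exp]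
  ring

lemma exitRate_remRates (lam : ℝ) (w : Fin n → ℝ) (i : Fin n) :
    exitRate (remRates G lam w) i
      = exp (lam * w i) * ∑ j ∈ G.neighborFinset i, exp (-(1 - lam) * w j) := by
  have hN : G.neighborFinset i = (Finset.univ.erase i).filter (fun j => G.Adj i j) := by
    ext j
    simp only [SimpleGraph.mem_neighborFinset, Finset.mem_filter, Finset.mem_erase,
      Finset.mem_univ, and_true]
    exact ⟨fun h => ⟨h.ne', h⟩, fun h => h.2⟩
  rw [exitRate, hN, Finset.mul_sum, Finset.sum_filter]
  refine Finset.sum_congr rfl fun j _ => ?_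
  simp only [remRates, ← exp_add]
  split_ifs
  · congr 1; ring
  · rfl

lemma neighborFinset_nonempty (hG : G.Connected) (hn : 2 ≤ n) (i : Fin n) :
    (G.neighborFinset i).Nonempty := by
  have : Nontrivial (Fin n) := Fin.nontrivial_iff_two_le.2 hn
  obtain ⟨j, hj⟩ := hG.preconnected.exists_adj_of_nontrivial i
  exact ⟨j, by simpa using hj⟩

lemma sum_exp_neighborFinset_pos (hG : G.Connected) (hn : 2 ≤ n) (ε : ℝ) (w : Fin n → ℝ)
    (i : Fin n) : 0 < ∑ j ∈ G.neighborFinset i, exp (-ε * w j) :=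
  Finset.sum_pos (fun _ _ => exp_pos _) (neighborFinset_nonempty hG hn i)

lemma logExit_remRates (hG : G.Connected) (hn : 2 ≤ n) (lam : ℝ) (w : Fin n → ℝ) :
    logExit (remRates G lam w) = fun i => lam * w i + logNbrSum G (1 - lam) w i := by
  funext i
  rw [logExit, exitRate_remRates,
    log_mul (exp_ne_zero _) (sum_exp_neighborFinset_pos hG hn _ w i).ne', log_exp, logNbrSum]

end REM

/-! ### Correlations -/

section Correlation

variable {Ω : Type*} [MeasurableSpace Ω] {P : Measure Ω} [IsProbabilityMeasure P] {u v : Ω → ℝ}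

lemma variance_sub_const_mul (hu : MemLp u 2 P) (hv : MemLp v 2 P) (t : ℝ) :
    Var[fun ω => v ω - t * u ω; P] = Var[v; P] + t ^ 2 * Var[u; P] - 2 * t * cov[u, v; P] := by
  rw [variance_fun_sub hv (hu.const_mul t), variance_const_mul, covariance_const_mul_right,
    covariance_comm]
  ring

/-- The Cauchy-Schwarz inequality for covariances. -/
lemma covariance_sq_le (hu : MemLp u 2 P) (hv : MemLp v 2 P) :
    cov[u, v; P] ^ 2 ≤ Var[u; P] * Var[v; P] := by
  have h : ∀ t : ℝ, 0 ≤ Var[u; P] * (t * t) + (-2 * cov[u, v; P]) * t + Var[v; P] := fun t => by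
    have := variance_nonneg (fun ω => v ω - t * u ω) P
    rw [variance_sub_const_mul hu hv] at this
    linarith
  have := discrim_le_zero h
  rw [discrim] at this
  linarith

lemma abs_correlation_le_one (hu : MemLp u 2 P) (hv : MemLp v 2 P) :
    |cov[u, v; P] / √(Var[u; P] * Var[v; P])| ≤ 1 := by
  rw [abs_div, abs_of_nonneg (sqrt_nonneg _)]
  exact div_le_one_of_le₀ (abs_le_sqrt (covariance_sq_le hu hv)) (sqrt_nonneg _)

/-- Here `r` plays the correlation, `a` and `b` the standard deviations of `t * u` and `v`. For `r ≥
0` the bracket is `(b - r a)² + (1 - r²) a²`, and `2 (1 - r²) ≥ 1 - r`; for `r < 0` the cross term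
only helps, and `1 - r ≤ 2`. -/
lemma one_sub_mul_sq_le {a b r : ℝ} (ha : 0 ≤ a) (hb : 0 ≤ b) (hr : |r| ≤ 1) :
    (1 - r) * a ^ 2 ≤ 2 * (b ^ 2 + a ^ 2 - 2 * (r * (a * b))) := by
  obtain ⟨h1, h2⟩ := abs_le.1 hr
  rcases le_or_gt 0 r with h | h
  · nlinarith [sq_nonneg (b - r * a),
      mul_nonneg (mul_nonneg (sub_nonneg.2 h2) (by linarith : 0 ≤ 1 + 2 * r)) (sq_nonneg a)]
  · nlinarith [mul_nonneg (mul_nonneg ha hb) (neg_pos.2 h).le, sq_nonneg b,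
      mul_nonneg (by linarith : 0 ≤ 1 + r) (sq_nonneg a)]

/-- The correlation of `u` and `v` is close to `1` if `v` is close to a positive multiple of `u`. -/
lemma one_sub_correlation_le (hu : MemLp u 2 P) (hv : MemLp v 2 P) {t : ℝ} (ht : 0 < t)
    (hpos : 0 < Var[u; P]) :
    1 - cov[u, v; P] / √(Var[u; P] * Var[v; P])
      ≤ 2 * Var[fun ω => v ω - t * u ω; P] / (t ^ 2 * Var[u; P]) := by
  have hcs := abs_correlation_le_one hu hv
  have hcs' := covariance_sq_le hu hv
  rw [variance_sub_const_mul hu hv, le_div_iff₀ (by positivity)]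
  rw [sqrt_mul hpos.le] at hcs ⊢
  have hA : 0 < √(Var[u; P]) := sqrt_pos.2 hpos
  have hA2 : √(Var[u; P]) ^ 2 = Var[u; P] := sq_sqrt hpos.le
  have hB2 : √(Var[v; P]) ^ 2 = Var[v; P] := sq_sqrt (variance_nonneg _ _)
  set c := cov[u, v; P]
  set A := √(Var[u; P])
  set B := √(Var[v; P])
  rw [← hA2, ← hB2] at hcs' ⊢
  have hB : 0 ≤ B := sqrt_nonneg _
  -- If `B = 0` the quotient is `0` by convention, and Cauchy-Schwarz forces `c = 0`.
  have hc : c = c / (A * B) * (A * B) := by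
    rcases hB.eq_or_lt with h | h
    · rw [← h] at hcs' ⊢
      have : c ^ 2 ≤ 0 := by simpa using hcs'
      have : c = 0 := by nlinarith
      simp [this]
    · field_simp
  have := one_sub_mul_sq_le (mul_nonneg ht.le hA.le) hB hcs
  calc (1 - c / (A * B)) * (t ^ 2 * A ^ 2) = (1 - c / (A * B)) * (t * A) ^ 2 := by ring
    _ ≤ _ := this
    _ = 2 * (B ^ 2 + t ^ 2 * A ^ 2 - 2 * t * (c / (A * B) * (A * B))) := by ring
    _ = _ := by rw [← hc]

end Correlation

/-! ### Variances over a uniformly random state -/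

section Uniform

variable {n : ℕ}

instance [NeZero n] : IsProbabilityMeasure (unifState n) :=
  inferInstanceAs (IsProbabilityMeasure (uniformOn Set.univ))

lemma memLp_unifState [NeZero n] (f : Fin n → ℝ) : MemLp f 2 (unifState n) :=
  MemLp.of_discrete

lemma integral_unifState [NeZero n] (f : Fin n → ℝ) :
    ∫ i, f i ∂unifState n = (∑ i, f i) / n := by
  rw [integral_fintype ((memLp_unifState f).integrable one_le_two), Finset.sum_div]
  refine Finset.sum_congr rfl fun i _ => ?_
  have : (unifState n).real {i} = (n : ℝ)⁻¹ := by
    rw [Measure.real, unifState, uniformOn_univ]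
    simp
  rw [this, smul_eq_mul, inv_mul_eq_div]

lemma variance_unifState [NeZero n] (f : Fin n → ℝ) :
    Var[f; unifState n] = (∑ i, (f i - (∑ k, f k) / n) ^ 2) / n := by
  rw [variance_eq_integral Measurable.of_discrete.aemeasurable, integral_unifState,
    integral_unifState]

lemma variance_unifState_eq_sub [NeZero n] (f : Fin n → ℝ) :
    Var[f; unifState n] = (∑ i, f i ^ 2) / n - ((∑ i, f i) / n) ^ 2 := by
  rw [variance_eq_sub (memLp_unifState f), integral_unifState, integral_unifState]
  rfl

lemma variance_unifState_le [NeZero n] (f : Fin n → ℝ) (c : ℝ) :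
    Var[f; unifState n] ≤ (∑ i, (f i - c) ^ 2) / n := by
  have := variance_le_expectation_sq (μ := unifState n) (X := fun i => f i - c)
    Measurable.of_discrete.aestronglyMeasurable
  rw [variance_sub_const Measurable.of_discrete.aestronglyMeasurable, integral_unifState] at this
  exact this

/-- Two squared deviations from the mean already sum to at least half of `(f i - f k) ^ 2`. -/
lemma sq_sub_le_variance_unifState [NeZero n] (f : Fin n → ℝ) (i k : Fin n) :
    (f i - f k) ^ 2 ≤ 2 * n * Var[f; unifState n] := by
  have hn : (0 : ℝ) < n := Nat.cast_pos.2 (NeZero.pos n)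
  rw [variance_unifState, mul_assoc, mul_div_cancel₀ _ hn.ne']
  set m := (∑ k, f k) / n
  rcases eq_or_ne i k with rfl | hik
  · rw [sub_self]
    have : 0 ≤ ∑ j, (f j - m) ^ 2 := Finset.sum_nonneg fun _ _ => sq_nonneg _
    nlinarith
  · have : (f i - m) ^ 2 + (f k - m) ^ 2 ≤ ∑ j, (f j - m) ^ 2 := by
      rw [← Finset.sum_pair (f := fun j => (f j - m) ^ 2) hik]
      exact Finset.sum_le_sum_of_subset_of_nonneg (Finset.subset_univ _) fun _ _ _ => sq_nonneg _
    nlinarith [sq_nonneg (f i + f k - 2 * m)]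

lemma variance_unifState_pos [NeZero n] {f : Fin n → ℝ} {i k : Fin n} (h : f i ≠ f k) :
    0 < Var[f; unifState n] := by
  have h1 := sq_sub_le_variance_unifState f i k
  have h2 : 0 < (f i - f k) ^ 2 := by have := sub_ne_zero.2 h; positivity
  have hn : (0 : ℝ) < n := Nat.cast_pos.2 (NeZero.pos n)
  by_contra hle
  nlinarith [mul_nonneg hn.le (sub_nonneg.2 (not_lt.1 hle))]

/-- If all values of `f` lie in an interval of `K` times the length of the range of `w`, then the
variance of `f` is controlled by that of `w`. -/
lemma variance_unifState_le_of_range [NeZero n] {f w : Fin n → ℝ} {K c : ℝ}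
    (h : ∀ a b, (∀ i, w i ∈ Set.Icc a b) → ∀ i, f i ∈ Set.Icc (c - K * b) (c - K * a)) :
    Var[f; unifState n] ≤ n * K ^ 2 / 2 * Var[w; unifState n] := by
  obtain ⟨i, -, hi⟩ := Finset.exists_max_image Finset.univ w Finset.univ_nonempty
  obtain ⟨k, -, hk⟩ := Finset.exists_min_image Finset.univ w Finset.univ_nonempty
  -- Popoviciu's inequality: the variance is at most a quarter of the squared range.
  have h1 := variance_le_sq_of_bounded (μ := unifState n) (X := f)
    (ae_of_all _ (h (w k) (w i) fun j => ⟨hk j (Finset.mem_univ j), hi j (Finset.mem_univ j)⟩))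
    Measurable.of_discrete.aemeasurable
  have h2 := sq_sub_le_variance_unifState w i k
  calc _ ≤ _ := h1
    _ = K ^ 2 / 4 * (w i - w k) ^ 2 := by ring
    _ ≤ K ^ 2 / 4 * (2 * n * Var[w; unifState n]) := by gcongr
    _ = _ := by ring

end Uniform

section REM

variable {n : ℕ} {G : SimpleGraph (Fin n)} [DecidableRel G.Adj]

/-- Replacing every value by an extreme one leaves `d` equal terms. Regularity makes the offset `log
d` common to all vertices, so it does not contribute to the variance. -/
lemma logNbrSum_mem_Icc (hG : G.Connected) (hn : 2 ≤ n) {d : ℕ} (hd : G.IsRegularOfDegree d)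
    {ε : ℝ} (hε : 0 ≤ ε) {w : Fin n → ℝ} {a b : ℝ} (h : ∀ i, w i ∈ Set.Icc a b) (i : Fin n) :
    logNbrSum G ε w i ∈ Set.Icc (log d - ε * b) (log d - ε * a) := by
  have hd0 : (0 : ℝ) < d := by
    rw [← hd i, ← SimpleGraph.card_neighborFinset_eq_degree, Nat.cast_pos, Finset.card_pos]
    exact neighborFinset_nonempty hG hn i
  have hcard : ((G.neighborFinset i).card : ℝ) = d := by
    rw [SimpleGraph.card_neighborFinset_eq_degree, hd i]
  have key : ∀ x : ℝ, log d - ε * x = log (∑ _j ∈ G.neighborFinset i, exp (-ε * x)) := fun x => by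
    rw [Finset.sum_const, nsmul_eq_mul, hcard, log_mul hd0.ne' (exp_ne_zero _), log_exp]
    ring
  have hpos : ∀ x : ℝ, 0 < ∑ _j ∈ G.neighborFinset i, exp (-ε * x) := fun x =>
    sum_exp_neighborFinset_pos hG hn ε (fun _ => x) i
  rw [key, key, logNbrSum]
  constructor
  · refine log_le_log (hpos b) (Finset.sum_le_sum fun j _ => exp_le_exp.2 ?_)
    nlinarith [(h j).2]
  · refine log_le_log (sum_exp_neighborFinset_pos hG hn ε w i)
      (Finset.sum_le_sum fun j _ => exp_le_exp.2 ?_)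
    nlinarith [(h j).1]

lemma variance_logNbrSum_le [NeZero n] (hG : G.Connected) (hn : 2 ≤ n) {d : ℕ}
    (hd : G.IsRegularOfDegree d) {ε : ℝ} (hε : 0 ≤ ε) (w : Fin n → ℝ) :
    Var[logNbrSum G ε w; unifState n] ≤ n * ε ^ 2 / 2 * Var[w; unifState n] :=
  variance_unifState_le_of_range fun _ _ h => logNbrSum_mem_Icc hG hn hd hε h

lemma rho_remRates [NeZero n] (hG : G.Connected) (hn : 2 ≤ n) (lam : ℝ) (w : Fin n → ℝ) :
    rho (remRates G lam w)
      = cov[w, fun i => lam * w i + logNbrSum G (1 - lam) w i; unifState n] /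
        √(Var[w; unifState n] *
          Var[fun i => lam * w i + logNbrSum G (1 - lam) w i; unifState n]) := by
  rw [rho, effPotential_remRates hG, logExit_remRates hG hn,
    covariance_add_const_left ((memLp_unifState w).integrable one_le_two),
    variance_add_const (memLp_unifState w).aestronglyMeasurable]

lemma abs_rho_remRates_le [NeZero n] (hG : G.Connected) (hn : 2 ≤ n) (lam : ℝ)
    (w : Fin n → ℝ) : |rho (remRates G lam w)| ≤ 1 := by
  rw [rho_remRates hG hn]
  exact abs_correlation_le_one (memLp_unifState _) (memLp_unifState _)

lemma one_sub_rho_remRates_le [NeZero n] (hG : G.Connected) (hn : 2 ≤ n) {lam : ℝ}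
    (hlam : 0 < lam) {w : Fin n → ℝ} (hw : 0 < Var[w; unifState n]) :
    1 - rho (remRates G lam w)
      ≤ 2 * Var[logNbrSum G (1 - lam) w; unifState n] / (lam ^ 2 * Var[w; unifState n]) := by
  rw [rho_remRates hG hn]
  refine (one_sub_correlation_le (memLp_unifState _) (memLp_unifState _) hlam hw).trans_eq ?_
  congr 3
  funext i
  ring

end REM

/-! ### The Gaussian Poincaré inequality -/

section Poincare

/-- Cauchy-Schwarz against the constant `1`, from the nonnegativity of the integrated squared
deviation of `g` from its mean `I / b`. -/
lemma sq_intervalIntegral_le {g : ℝ → ℝ} (hg : Continuous g) {b : ℝ} (hb : 0 < b) :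
    (∫ t in (0 : ℝ)..b, g t) ^ 2 ≤ b * ∫ t in (0 : ℝ)..b, g t ^ 2 := by
  set I := ∫ t in (0 : ℝ)..b, g t
  have h0 : 0 ≤ ∫ t in (0 : ℝ)..b, (g t - I / b) ^ 2 :=
    intervalIntegral.integral_nonneg hb.le fun _ _ => sq_nonneg _
  have h1 : ∫ t in (0 : ℝ)..b, (g t - I / b) ^ 2
      = (∫ t in (0 : ℝ)..b, g t ^ 2) - 2 * (I / b) * I + b * (I / b) ^ 2 := by
    have : ∀ t, (g t - I / b) ^ 2 = g t ^ 2 - 2 * (I / b) * g t + (I / b) ^ 2 := fun t => by ring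
    simp_rw [this]
    rw [intervalIntegral.integral_add, intervalIntegral.integral_sub,
      intervalIntegral.integral_const_mul, intervalIntegral.integral_const, smul_eq_mul, sub_zero]
    all_goals exact Continuous.intervalIntegrable (by fun_prop) _ _
  rw [h1] at h0
  have h2 : b * (I / b) = I := mul_div_cancel₀ I hb.ne'
  have h3 : b * ((∫ t in (0 : ℝ)..b, g t ^ 2) - 2 * (I / b) * I + b * (I / b) ^ 2)
      = b * (∫ t in (0 : ℝ)..b, g t ^ 2) - I ^ 2 := by
    linear_combination (b * (I / b) - I) * h2
  have := mul_nonneg hb.le h0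
  linarith

variable {ι : Type*} [Fintype ι] (v : NNReal)

instance : IsGaussian (Measure.pi fun _ : ι => gaussianReal 0 v) := by
  have h := (iIndepFun_pi (μ := fun _ : ι => gaussianReal 0 v) (X := fun _ x => x)
    fun _ => aemeasurable_id).hasGaussianLaw fun i =>
      (⟨(measurable_pi_apply i).aemeasurable, (measurePreserving_eval _ i).map_eq⟩ :
        HasLaw (fun x : ι → ℝ => x i) (gaussianReal 0 v) _).hasGaussianLaw
  have h2 := h.isGaussian_map
  rwa [show (fun x : ι → ℝ => fun i => x i) = id from rfl, Measure.map_id] at h2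

lemma memLp_gaussianReal_const_mul (c : ℝ) :
    MemLp (fun x : ℝ => c * x) 2 (gaussianReal 0 v) :=
  (memLp_id_gaussianReal 2).const_mul c

lemma integral_strongDual_pi_gaussianReal (L : StrongDual ℝ (ι → ℝ)) :
    ∫ x, L x ∂(Measure.pi fun _ : ι => gaussianReal 0 v) = 0 := by
  classical
  have hL : ∀ x, L x = ∑ i, x i * L (Pi.single i 1) := fun x => by
    conv_lhs => rw [pi_eq_sum_univ' x, map_sum]
    exact Finset.sum_congr rfl fun i _ => by rw [map_smul, smul_eq_mul]
  rw [integral_congr_ae (ae_of_all _ hL)]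
  have hint : ∀ i : ι, ∫ x, x i ∂(Measure.pi fun _ : ι => gaussianReal 0 v) = 0 := fun i => by
    rw [integral_comp_eval (μ := fun _ : ι => gaussianReal 0 v) (i := i) (f := fun x => x)
      aestronglyMeasurable_id, integral_id_gaussianReal]
  rw [integral_finsetSum]
  · simp [integral_mul_const, hint]
  · intro i _
    exact (integrable_comp_eval (μ := fun _ : ι => gaussianReal 0 v) (i := i) (f := fun x => x)
      ((memLp_id_gaussianReal 1).integrable le_rfl)).mul_const _

lemma variance_strongDual_pi_gaussianReal [DecidableEq ι] (L : StrongDual ℝ (ι → ℝ)) :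
    Var[L; Measure.pi fun _ : ι => gaussianReal 0 v] = v * ∑ i, L (Pi.single i 1) ^ 2 := by
  have hL : (L : (ι → ℝ) → ℝ) = ∑ i, fun x : ι → ℝ => L (Pi.single i 1) * x i := by
    funext x
    rw [Finset.sum_apply]
    conv_lhs => rw [pi_eq_sum_univ' x, map_sum]
    exact Finset.sum_congr rfl fun i _ => by rw [map_smul, smul_eq_mul, mul_comm]
  refine (congrArg (fun X => Var[X; Measure.pi fun _ : ι => gaussianReal 0 v]) hL).trans ?_
  rw [variance_sum_pi (X := fun i x => L (Pi.single i 1) * x)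
    fun i => memLp_gaussianReal_const_mul v _, Finset.mul_sum]
  refine Finset.sum_congr rfl fun i _ => ?_
  rw [variance_const_mul, variance_fun_id_gaussianReal, mul_comm]

lemma lintegral_sq_strongDual_pi_gaussianReal [DecidableEq ι] (L : StrongDual ℝ (ι → ℝ)) :
    ∫⁻ x, ENNReal.ofReal (L x ^ 2) ∂(Measure.pi fun _ : ι => gaussianReal 0 v)
      = ENNReal.ofReal (v * ∑ i, L (Pi.single i 1) ^ 2) := by
  have hmem : MemLp L 2 (Measure.pi fun _ : ι => gaussianReal 0 v) :=
    IsGaussian.memLp_dual _ L 2 (by simp)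
  rw [← variance_strongDual_pi_gaussianReal,
    variance_of_integral_eq_zero hmem.aemeasurable (integral_strongDual_pi_gaussianReal v L),
    ofReal_integral_eq_lintegral_ofReal hmem.integrable_sq (ae_of_all _ fun _ => sq_nonneg _)]

variable {f : (ι → ℝ) → ℝ} {f' : (ι → ℝ) → StrongDual ℝ (ι → ℝ)}

/-- The increment of `f` along a quarter of an ellipse. -/
lemma sq_sub_le_lintegral_rotation (hf : ∀ x, HasFDerivAt f (f' x) x) (hf' : Continuous f')
    (p : (ι → ℝ) × (ι → ℝ)) :
    ENNReal.ofReal ((f p.2 - f p.1) ^ 2)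
      ≤ ENNReal.ofReal (π / 2) * ∫⁻ t in Set.Ioc 0 (π / 2), ENNReal.ofReal
        (f' (ContinuousLinearMap.rotation t p).1 (ContinuousLinearMap.rotation t p).2 ^ 2) := by
  set g : ℝ → ℝ := fun t =>
    f' (ContinuousLinearMap.rotation t p).1 (ContinuousLinearMap.rotation t p).2 with hg
  have hgc : Continuous g := by
    simp only [hg, ContinuousLinearMap.rotation_apply]
    fun_prop
  have hder : ∀ t, HasDerivAt (fun t => f (ContinuousLinearMap.rotation t p).1) (g t) t := by
    intro t
    -- The first component `cos t • p.1 + sin t • p.2` runs from `p.1` to `p.2` as `t` goes from `0`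
    -- to `π / 2`, and its velocity is the second component.
    have h1 : HasDerivAt (fun t => (ContinuousLinearMap.rotation t p).1)
        (ContinuousLinearMap.rotation t p).2 t := by
      simp only [ContinuousLinearMap.rotation_apply]
      exact ((hasDerivAt_cos t).smul_const p.1).add ((hasDerivAt_sin t).smul_const p.2)
    exact (hf _).comp_hasDerivAt t h1
  have hFTC : ∫ t in (0 : ℝ)..(π / 2), g t = f p.2 - f p.1 := by
    rw [intervalIntegral.integral_eq_sub_of_hasDerivAt (fun t _ => hder t)
      (hgc.intervalIntegrable _ _)]
    simp [ContinuousLinearMap.rotation_apply]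
  have hpi : 0 < π / 2 := by positivity
  rw [← hFTC, ← ofReal_integral_eq_lintegral_ofReal, ← ENNReal.ofReal_mul hpi.le,
    ← intervalIntegral.integral_of_le hpi.le]
  · exact ENNReal.ofReal_le_ofReal (sq_intervalIntegral_le hgc hpi)
  · exact ((hgc.pow 2).intervalIntegrable 0 (π / 2)).1
  · exact ae_of_all _ fun _ => sq_nonneg _

/-- At each angle the rotated pair is again a pair of independent Gaussian vectors, so given the
first one, `f' x y` has second moment `v` times the squared gradient norm at `x`. One factor `π / 2`
comes from Cauchy-Schwarz and one from the length of the interval. -/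
lemma lintegral_sq_sub_le_of_gradient_le [DecidableEq ι] (hf : ∀ x, HasFDerivAt f (f' x) x)
    (hf' : Continuous f') {K : ℝ} (hK : ∀ x, ∑ i, f' x (Pi.single i 1) ^ 2 ≤ K ^ 2) :
    ∫⁻ p, ENNReal.ofReal ((f p.2 - f p.1) ^ 2)
      ∂((Measure.pi fun _ : ι => gaussianReal 0 v).prod (Measure.pi fun _ : ι => gaussianReal 0 v))
      ≤ ENNReal.ofReal (π ^ 2 / 4 * (v * K ^ 2)) := by
  set μ := Measure.pi fun _ : ι => gaussianReal 0 v with hμ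
  have hcont : Continuous fun p : (ι → ℝ) × (ι → ℝ) => f' p.1 p.2 := by fun_prop
  have hmeas : Measurable fun p : (ι → ℝ) × (ι → ℝ) => ENNReal.ofReal (f' p.1 p.2 ^ 2) :=
    (hcont.pow 2).measurable.ennreal_ofReal
  have hrot : ∀ t, ∫⁻ p, ENNReal.ofReal
      (f' (ContinuousLinearMap.rotation t p).1 (ContinuousLinearMap.rotation t p).2 ^ 2) ∂(μ.prod μ)
      ≤ ENNReal.ofReal (v * K ^ 2) := by
    intro t
    rw [← lintegral_map (f := fun p : (ι → ℝ) × (ι → ℝ) => ENNReal.ofReal (f' p.1 p.2 ^ 2)) hmeas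
      (ContinuousLinearMap.continuous _).measurable,
      IsGaussian.map_rotation_eq_self_of_forall_strongDual_eq_zero
        (integral_strongDual_pi_gaussianReal v), lintegral_prod _ hmeas.aemeasurable]
    calc _ ≤ ∫⁻ _, ENNReal.ofReal (v * K ^ 2) ∂μ := by
          refine lintegral_mono fun x => ?_
          change ∫⁻ y, ENNReal.ofReal (f' x y ^ 2) ∂μ ≤ _
          rw [hμ, lintegral_sq_strongDual_pi_gaussianReal]
          exact ENNReal.ofReal_le_ofReal (mul_le_mul_of_nonneg_left (hK x) v.2)
      _ = _ := by simp
  calc _ ≤ ∫⁻ p, ENNReal.ofReal (π / 2) * (∫⁻ t in Set.Ioc 0 (π / 2), ENNReal.ofReal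
        (f' (ContinuousLinearMap.rotation t p).1 (ContinuousLinearMap.rotation t p).2 ^ 2))
          ∂(μ.prod μ) := lintegral_mono fun p => sq_sub_le_lintegral_rotation hf hf' p
    _ = ENNReal.ofReal (π / 2) * ∫⁻ t in Set.Ioc 0 (π / 2), ∫⁻ p, ENNReal.ofReal
        (f' (ContinuousLinearMap.rotation t p).1 (ContinuousLinearMap.rotation t p).2 ^ 2)
          ∂(μ.prod μ) := by
      rw [lintegral_const_mul' _ _ ENNReal.ofReal_ne_top, lintegral_lintegral_swap]
      refine (Continuous.measurable ?_).ennreal_ofReal.aemeasurable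
      simp only [ContinuousLinearMap.rotation_apply]
      fun_prop
    _ ≤ ENNReal.ofReal (π / 2) * ∫⁻ _ in Set.Ioc 0 (π / 2), ENNReal.ofReal (v * K ^ 2) := by
      gcongr with t
      exact hrot t
    _ = _ := by
      rw [setLIntegral_const, Real.volume_Ioc, ← ENNReal.ofReal_mul (by positivity),
        ← ENNReal.ofReal_mul (by positivity)]
      congr 1
      ring

/-- A Gaussian Poincaré inequality (with the constant `π ^ 2 / 8`). -/
lemma variance_pi_gaussianReal_le_of_gradient_le [DecidableEq ι]
    (hf : ∀ x, HasFDerivAt f (f' x) x) (hf' : Continuous f') {K : ℝ}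
    (hK : ∀ x, ∑ i, f' x (Pi.single i 1) ^ 2 ≤ K ^ 2)
    (hmem : MemLp f 2 (Measure.pi fun _ : ι => gaussianReal 0 v)) :
    Var[f; Measure.pi fun _ : ι => gaussianReal 0 v] ≤ π ^ 2 / 8 * (v * K ^ 2) := by
  set μ := Measure.pi fun _ : ι => gaussianReal 0 v with hμ
  have hfc : Continuous f := continuous_iff_continuousAt.2 fun x => (hf x).continuousAt
  -- The difference of two independent copies has twice the variance, which turns `π ^ 2 / 4` into
  -- `π ^ 2 / 8`.
  have h1 : Var[fun p : (ι → ℝ) × (ι → ℝ) => (-f) p.1 + f p.2; μ.prod μ] = 2 * Var[f; μ] := by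
    rw [variance_add_prod hmem.neg hmem, variance_neg]
    ring
  have hcont : Continuous fun p : (ι → ℝ) × (ι → ℝ) => (-f) p.1 + f p.2 := by
    simp only [Pi.neg_apply]; fun_prop
  have h2 : Var[fun p : (ι → ℝ) × (ι → ℝ) => (-f) p.1 + f p.2; μ.prod μ]
      ≤ ∫ p, ((-f) p.1 + f p.2) ^ 2 ∂(μ.prod μ) :=
    variance_le_expectation_sq hcont.aestronglyMeasurable
  have h3 : ∫ p, ((-f) p.1 + f p.2) ^ 2 ∂(μ.prod μ) ≤ π ^ 2 / 4 * (v * K ^ 2) := by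
    rw [integral_eq_lintegral_of_nonneg_ae (ae_of_all _ fun _ => sq_nonneg _)
      (hcont.pow 2).aestronglyMeasurable]
    refine ENNReal.toReal_le_of_le_ofReal (by positivity) ?_
    refine le_trans (le_of_eq ?_) (lintegral_sq_sub_le_of_gradient_le v hf hf' hK)
    refine lintegral_congr fun p => ?_
    simp only [Pi.neg_apply]
    congr 2
    ring
  rw [h1] at h2
  linarith

end Poincare

/-! ### The logarithmic neighbour sums of a Gaussian vector -/

section LogNbrSum

variable {n : ℕ} {G : SimpleGraph (Fin n)} [DecidableRel G.Adj]

@[fun_prop]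
lemma measurable_logNbrSum (ε : ℝ) (i : Fin n) :
    Measurable fun w : Fin n → ℝ => logNbrSum G ε w i := by
  unfold logNbrSum
  fun_prop

variable (G) in
/-- The derivative of `logNbrSum`. -/
noncomputable def logNbrSumDeriv (ε : ℝ) (i : Fin n) (w : Fin n → ℝ) :
    StrongDual ℝ (Fin n → ℝ) :=
  (∑ j ∈ G.neighborFinset i, exp (-ε * w j))⁻¹ • ∑ j ∈ G.neighborFinset i,
    exp (-ε * w j) • (-ε) • (ContinuousLinearMap.proj j : StrongDual ℝ (Fin n → ℝ))

lemma hasFDerivAt_logNbrSum (hG : G.Connected) (hn : 2 ≤ n) (ε : ℝ) (i : Fin n) (w : Fin n → ℝ) :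
    HasFDerivAt (fun w => logNbrSum G ε w i) (logNbrSumDeriv G ε i w) w := by
  refine HasFDerivAt.log ?_ (sum_exp_neighborFinset_pos hG hn ε w i).ne'
  refine HasFDerivAt.fun_sum fun j _ => HasFDerivAt.exp ?_
  exact (hasFDerivAt_apply j w).const_mul (-ε)

lemma continuous_logNbrSumDeriv (hG : G.Connected) (hn : 2 ≤ n) (ε : ℝ) (i : Fin n) :
    Continuous (logNbrSumDeriv G ε i) := by
  unfold logNbrSumDeriv
  refine Continuous.smul (Continuous.inv₀ (by fun_prop)
    fun w => (sum_exp_neighborFinset_pos hG hn ε w i).ne') (by fun_prop)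

/-- The gradient is `-ε` times a probability vector (a softmax), whose Euclidean norm is at most its
`ℓ¹` norm `1`. The bound does not depend on the degree. -/
lemma sum_sq_logNbrSumDeriv_le (hG : G.Connected) (hn : 2 ≤ n) (ε : ℝ) (i : Fin n)
    (w : Fin n → ℝ) : ∑ k, logNbrSumDeriv G ε i w (Pi.single k 1) ^ 2 ≤ ε ^ 2 := by
  set S := ∑ j ∈ G.neighborFinset i, exp (-ε * w j) with hS
  have hSpos : 0 < S := sum_exp_neighborFinset_pos hG hn ε w i
  set a : Fin n → ℝ := fun k => if k ∈ G.neighborFinset i then exp (-ε * w k) else 0 with ha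
  have hval : ∀ k, logNbrSumDeriv G ε i w (Pi.single k 1) = S⁻¹ * -ε * a k := by
    intro k
    simp only [logNbrSumDeriv, FunLike.coe_smul, Pi.smul_apply, smul_eq_mul,
      FunLike.coe_sum, Finset.sum_apply, ContinuousLinearMap.proj_apply]
    rw [← hS, mul_assoc]
    congr 1
    simp only [Pi.single_apply, mul_ite, mul_one, mul_zero, ha]
    rw [Finset.sum_ite_eq', mul_comm (exp _)]
  have hsum : ∑ k, a k = S := by
    simp only [ha]
    rw [Finset.sum_ite_mem, Finset.univ_inter]
  have hle : ∑ k, a k ^ 2 ≤ S ^ 2 := by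
    rw [← hsum]
    refine Finset.sum_sq_le_sq_sum_of_nonneg fun k _ => ?_
    simp only [ha]
    split_ifs <;> positivity
  simp_rw [hval, mul_pow, ← Finset.mul_sum]
  calc S⁻¹ ^ 2 * (-ε) ^ 2 * ∑ k, a k ^ 2 ≤ S⁻¹ ^ 2 * (-ε) ^ 2 * S ^ 2 := by gcongr
    _ = ε ^ 2 := by field_simp

lemma memLp_logNbrSum (hG : G.Connected) (hn : 2 ≤ n) {d : ℕ} (hd : G.IsRegularOfDegree d)
    {ε : ℝ} (hε : 0 ≤ ε) (v : NNReal) (i : Fin n) :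
    MemLp (fun w => logNbrSum G ε w i) 2 (Measure.pi fun _ : Fin n => gaussianReal 0 v) := by
  have hnorm : MemLp (fun w : Fin n → ℝ => ‖w‖) 2
      (Measure.pi fun _ : Fin n => gaussianReal 0 v) := (IsGaussian.memLp_id _ 2 (by simp)).norm
  have h1 : MemLp (fun w : Fin n → ℝ => |log d| + ε * ‖w‖) 2
      (Measure.pi fun _ : Fin n => gaussianReal 0 v) :=
    (memLp_const |log (d : ℝ)|).add (hnorm.const_mul ε)
  refine h1.mono (measurable_logNbrSum ε i).aestronglyMeasurable (ae_of_all _ fun w => ?_)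
  obtain ⟨h2, h3⟩ := logNbrSum_mem_Icc hG hn hd hε (w := w) (a := -‖w‖) (b := ‖w‖)
    (fun i => abs_le.1 (norm_le_pi_norm w i)) i
  rw [norm_eq_abs, norm_eq_abs, abs_of_nonneg (a := |log d| + ε * ‖w‖) (by positivity), abs_le]
  constructor
  · linarith [neg_abs_le (log (d : ℝ))]
  · linarith [le_abs_self (log (d : ℝ))]

lemma variance_logNbrSum_gaussian_le (hG : G.Connected) (hn : 2 ≤ n) {d : ℕ}
    (hd : G.IsRegularOfDegree d) {ε : ℝ} (hε : 0 ≤ ε) (v : NNReal) (i : Fin n) :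
    Var[fun w => logNbrSum G ε w i; Measure.pi fun _ : Fin n => gaussianReal 0 v]
      ≤ π ^ 2 / 8 * (v * ε ^ 2) :=
  variance_pi_gaussianReal_le_of_gradient_le v (hasFDerivAt_logNbrSum hG hn ε i)
    (continuous_logNbrSumDeriv hG hn ε i) (sum_sq_logNbrSumDeriv_le hG hn ε i)
    (memLp_logNbrSum hG hn hd hε v i)

/-- In a regular graph, `logNbrSum` has the same mean at all vertices. -/
lemma integral_logNbrSum_eq {d : ℕ} (hd : G.IsRegularOfDegree d) (ε : ℝ) (m : Measure ℝ)
    [SigmaFinite m] (i k : Fin n) :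
    ∫ w, logNbrSum G ε w i ∂(Measure.pi fun _ : Fin n => m)
      = ∫ w, logNbrSum G ε w k ∂(Measure.pi fun _ : Fin n => m) := by
  have hcard : (G.neighborFinset i).card = (G.neighborFinset k).card := by
    rw [SimpleGraph.card_neighborFinset_eq_degree, SimpleGraph.card_neighborFinset_eq_degree,
      hd i, hd k]
  -- A permutation carrying the neighbours of `i` to those of `k`; the product law is invariant
  -- under it.
  set e : Equiv.Perm (Fin n) := (Finset.equivOfCardEq hcard).extendSubtype
  have he : ∀ j, j ∈ G.neighborFinset i ↔ e j ∈ G.neighborFinset k := fun j =>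
    ⟨fun h => Equiv.extendSubtype_mem _ j h,
      fun h => by_contra fun h' => Equiv.extendSubtype_not_mem _ j h' h⟩
  rw [← (measurePreserving_piCongrLeft (fun _ : Fin n => m) e).integral_comp'
    (g := fun w => logNbrSum G ε w k)]
  refine integral_congr_ae (ae_of_all _ fun w => ?_)
  simp only [logNbrSum]
  congr 1
  refine Finset.sum_equiv e he fun j _ => ?_
  rw [MeasurableEquiv.piCongrLeft_apply_apply (β := fun _ => ℝ)]

lemma integrable_variance_logNbrSum [NeZero n] (hG : G.Connected) (hn : 2 ≤ n) {d : ℕ}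
    (hd : G.IsRegularOfDegree d) {ε : ℝ} (hε : 0 ≤ ε) (v : NNReal) :
    Integrable (fun w => Var[logNbrSum G ε w; unifState n])
      (Measure.pi fun _ : Fin n => gaussianReal 0 v) := by
  simp_rw [variance_unifState]
  refine (integrable_finsetSum _ fun i _ => ?_).div_const _
  refine MemLp.integrable_sq ((memLp_logNbrSum hG hn hd hε v i).sub ?_)
  simp_rw [div_eq_mul_inv]
  exact (memLp_finsetSum _ fun k _ => memLp_logNbrSum hG hn hd hε v k).mul_const _

/-- The empirical variance is at most the mean squared deviation from any constant; taking the
common expectation `c` reduces it to the Gaussian variances at single vertices. -/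
lemma integral_variance_logNbrSum_le [NeZero n] (hG : G.Connected) (hn : 2 ≤ n) {d : ℕ}
    (hd : G.IsRegularOfDegree d) {ε : ℝ} (hε : 0 ≤ ε) (v : NNReal) :
    ∫ w, Var[logNbrSum G ε w; unifState n] ∂(Measure.pi fun _ : Fin n => gaussianReal 0 v)
      ≤ π ^ 2 / 8 * (v * ε ^ 2) := by
  set μ := Measure.pi fun _ : Fin n => gaussianReal 0 v
  set c := ∫ w, logNbrSum G ε w 0 ∂μ with hc
  have hint : ∀ i, Integrable (fun w => (logNbrSum G ε w i - c) ^ 2) μ := fun i =>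
    ((memLp_logNbrSum hG hn hd hε v i).sub (memLp_const c)).integrable_sq
  calc ∫ w, Var[logNbrSum G ε w; unifState n] ∂μ
      ≤ ∫ w, (∑ i, (logNbrSum G ε w i - c) ^ 2) / n ∂μ :=
        integral_mono (integrable_variance_logNbrSum hG hn hd hε v)
          ((integrable_finsetSum _ fun i _ => hint i).div_const _)
          fun w => variance_unifState_le _ c
    _ = (∑ i, Var[fun w => logNbrSum G ε w i; μ]) / n := by
        rw [integral_div, integral_finsetSum _ fun i _ => hint i]
        congr 1
        refine Finset.sum_congr rfl fun i _ => ?_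
        rw [variance_eq_integral (measurable_logNbrSum ε i).aemeasurable,
          integral_logNbrSum_eq hd ε _ i 0]
    _ ≤ (∑ _i : Fin n, π ^ 2 / 8 * (v * ε ^ 2)) / n := by
        gcongr with i
        exact variance_logNbrSum_gaussian_le hG hn hd hε v i
    _ = π ^ 2 / 8 * (v * ε ^ 2) := by
        have hn0 : (n : ℝ) ≠ 0 := NeZero.ne _
        simp only [Finset.sum_const, Finset.card_univ, Fintype.card_fin, nsmul_eq_mul]
        field_simp

end LogNbrSum

/-! ### The empirical variance of a Gaussian vector -/

section EmpiricalVariance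

/-- At this parameter the tilt doubles the Gaussian exponent, which halves the variance. -/
lemma mgf_sq_gaussianReal {v : NNReal} (hv : v ≠ 0) :
    mgf (fun x : ℝ => x ^ 2) (gaussianReal 0 v) (-(2 * v : ℝ)⁻¹) = (√2)⁻¹ := by
  have hv' : (0 : ℝ) < v := NNReal.coe_pos.2 (pos_iff_ne_zero.2 hv)
  rw [mgf, integral_gaussianReal_eq_integral_smul hv]
  have h : ∀ x : ℝ, gaussianPDFReal 0 v x • exp (-(2 * v : ℝ)⁻¹ * x ^ 2)
      = (√(2 * π * v))⁻¹ * exp (-(v : ℝ)⁻¹ * x ^ 2) := fun x => by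
    rw [gaussianPDFReal, smul_eq_mul, mul_assoc, ← exp_add]
    congr 2
    field_simp
    ring
  simp_rw [h]
  rw [integral_const_mul, integral_gaussian, div_inv_eq_mul, mul_assoc 2 π, sqrt_mul zero_le_two]
  have : √(π * v) ≠ 0 := (sqrt_pos.2 (by positivity)).ne'
  field_simp

variable {ι : Type*} [Fintype ι]

lemma integrable_exp_neg_sum_sq (m : Measure ℝ) [IsProbabilityMeasure m] {t : ℝ} (ht : t ≤ 0) :
    Integrable (fun w : ι → ℝ => exp (t * ∑ i, w i ^ 2)) (Measure.pi fun _ => m) := by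
  refine Integrable.of_bound (C := 1) (Measurable.aestronglyMeasurable (by fun_prop))
    (ae_of_all _ fun w => ?_)
  rw [norm_of_nonneg (exp_pos _).le, exp_le_one_iff]
  exact mul_nonpos_of_nonpos_of_nonneg ht (Finset.sum_nonneg fun _ _ => sq_nonneg _)

lemma mgf_sum_pi (m : Measure ℝ) [IsProbabilityMeasure m] (X : ℝ → ℝ)
    (t : ℝ) : mgf (fun w : ι → ℝ => ∑ i, X (w i)) (Measure.pi fun _ => m) t
      = mgf X m t ^ Fintype.card ι := by
  simp only [mgf, Finset.mul_sum, exp_sum]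
  exact integral_fintype_prod_eq_pow fun x => exp (t * X x)

lemma measureReal_sum_sq_le {v : NNReal} (hv : v ≠ 0) :
    (Measure.pi fun _ : ι => gaussianReal 0 v).real
        {w | ∑ i, w i ^ 2 ≤ 3 / 5 * (Fintype.card ι * v)}
      ≤ (exp (3 / 10) * (√2)⁻¹) ^ Fintype.card ι := by
  have hv' : (0 : ℝ) < v := NNReal.coe_pos.2 (pos_iff_ne_zero.2 hv)
  have ht : -(2 * v : ℝ)⁻¹ ≤ 0 := by rw [neg_nonpos]; positivity
  refine (measure_le_le_exp_mul_mgf _ ht (integrable_exp_neg_sum_sq _ ht)).trans_eq ?_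
  rw [mgf_sum_pi _ (fun x => x ^ 2), mgf_sq_gaussianReal hv, mul_pow,
    ← exp_nat_mul]
  congr 2
  field_simp
  ring

lemma measureReal_le_sum {v : NNReal} (hv : v ≠ 0) :
    (Measure.pi fun _ : ι => gaussianReal 0 v).real
        {w | 3 / 10 * (Fintype.card ι * √v) ≤ ∑ i, w i}
      ≤ exp (-(9 / 200)) ^ Fintype.card ι := by
  have hv' : 0 < √(v : ℝ) := sqrt_pos.2 (NNReal.coe_pos.2 (pos_iff_ne_zero.2 hv))
  have hsq : (v : ℝ) = √v ^ 2 := (sq_sqrt v.2).symm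
  have ht : 0 ≤ 3 / 10 * (√(v : ℝ))⁻¹ := by positivity
  have hint : Integrable (fun w : ι → ℝ => exp (3 / 10 * (√(v : ℝ))⁻¹ * ∑ i, w i))
      (Measure.pi fun _ : ι => gaussianReal 0 v) := by
    simp only [Finset.mul_sum, exp_sum]
    exact Integrable.fintype_prod fun _ => integrable_exp_mul_gaussianReal _
  refine (measure_ge_le_exp_mul_mgf _ ht hint).trans_eq ?_
  rw [mgf_sum_pi _ (fun x => x), mgf_fun_id_gaussianReal, ← exp_nat_mul,
    ← exp_nat_mul, ← exp_add]
  congr 1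
  rw [hsq, sqrt_sq hv'.le]
  field_simp
  ring

lemma measureReal_sum_le {v : NNReal} (hv : v ≠ 0) :
    (Measure.pi fun _ : ι => gaussianReal 0 v).real
        {w | ∑ i, w i ≤ -(3 / 10 * (Fintype.card ι * √v))}
      ≤ exp (-(9 / 200)) ^ Fintype.card ι := by
  have h : MeasurePreserving (fun w : ι → ℝ => fun i => -w i)
      (Measure.pi fun _ : ι => gaussianReal 0 v) (Measure.pi fun _ : ι => gaussianReal 0 v) :=
    measurePreserving_pi _ _ fun _ => ⟨measurable_neg, by rw [gaussianReal_map_neg, neg_zero]⟩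
  refine le_trans (le_of_eq ?_) (measureReal_le_sum (ι := ι) hv)
  rw [← h.measureReal_preimage (measurableSet_le (by fun_prop) (by fun_prop)).nullMeasurableSet]
  congr 1
  ext w
  simp only [Set.mem_preimage, Set.mem_ofPred_eq, Finset.sum_neg_distrib]
  rw [neg_le_neg_iff]

/-- If the mean square exceeds `3/5 v` and the mean is below `3/10 √v` in absolute value, the
variance exceeds `(3/5 - 9/100) v > v / 2`. The three exceptional events have Chernoff bounds. -/
lemma measureReal_variance_unifState_lt {n : ℕ} [NeZero n] {v : NNReal} (hv : v ≠ 0) :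
    (Measure.pi fun _ : Fin n => gaussianReal 0 v).real {w | Var[w; unifState n] < v / 2}
      ≤ (exp (3 / 10) * (√2)⁻¹) ^ n + 2 * exp (-(9 / 200)) ^ n := by
  have hn : (0 : ℝ) < n := Nat.cast_pos.2 (NeZero.pos n)
  have hv' : (0 : ℝ) < v := NNReal.coe_pos.2 (pos_iff_ne_zero.2 hv)
  have hsub : {w : Fin n → ℝ | Var[w; unifState n] < v / 2}
      ⊆ {w | ∑ i, w i ^ 2 ≤ 3 / 5 * (Fintype.card (Fin n) * v)}
        ∪ ({w | 3 / 10 * (Fintype.card (Fin n) * √v) ≤ ∑ i, w i}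
          ∪ {w | ∑ i, w i ≤ -(3 / 10 * (Fintype.card (Fin n) * √v))}) := by
    intro w hw
    by_contra hcon
    simp only [Set.mem_union, Set.mem_ofPred_eq, Fintype.card_fin, not_or, not_le] at hcon hw
    obtain ⟨h1, h2, h3⟩ := hcon
    rw [variance_unifState_eq_sub] at hw
    have h4 : (∑ i, w i) / n < 3 / 10 * √v := by
      rw [div_lt_iff₀ hn]; linarith
    have h5 : -(3 / 10 * √v) < (∑ i, w i) / n := by
      rw [lt_div_iff₀ hn]; linarith
    have h6 : ((∑ i, w i) / n) ^ 2 < (3 / 10 * √v) ^ 2 := sq_lt_sq' h5 h4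
    rw [mul_pow, sq_sqrt hv'.le] at h6
    have h7 : 3 / 5 * v < (∑ i, w i ^ 2) / n := by
      rw [lt_div_iff₀ hn]; linarith
    linarith
  have h1 := measureReal_sum_sq_le (ι := Fin n) hv
  have h2 := measureReal_le_sum (ι := Fin n) hv
  have h3 := measureReal_sum_le (ι := Fin n) hv
  refine (measureReal_mono hsub).trans <| (measureReal_union_le _ _).trans ?_
  refine (add_le_add h1 ((measureReal_union_le _ _).trans (add_le_add h2 h3))).trans_eq ?_
  rw [Fintype.card_fin]
  ring

lemma exp_three_div_ten_mul_inv_sqrt_two_lt_one : exp (3 / 10) * (√2)⁻¹ < 1 := by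
  rw [← div_eq_mul_inv, div_lt_one (by positivity)]
  -- After squaring, the claim is `exp (3/5) < 2`, which four Taylor terms with remainder decide.
  refine lt_sqrt_of_sq_lt ?_
  rw [← exp_nat_mul]
  have h := exp_bound' (x := 3 / 5) (by norm_num) (by norm_num) (n := 4) (by norm_num)
  norm_num [Finset.sum_range_succ, Nat.factorial] at h ⊢
  linarith

/-- The empirical variance of `n` independent centered Gaussian variables is less than half of its
typical value with a probability that decays faster than `n⁻²`. -/
lemma exists_sq_mul_measureReal_variance_unifState_lt_le :
    ∃ K : ℝ, 0 ≤ K ∧ ∀ (n : ℕ) [NeZero n] (v : NNReal), v ≠ 0 →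
      (n : ℝ) ^ 2 * (Measure.pi fun _ : Fin n => gaussianReal 0 v).real
        {w | Var[w; unifState n] < v / 2} ≤ K := by
  have h1 := tendsto_pow_const_mul_const_pow_of_abs_lt_one 2
    (r := exp (3 / 10) * (√2)⁻¹) (by
      rw [abs_of_pos (by positivity)]; exact exp_three_div_ten_mul_inv_sqrt_two_lt_one)
  have h2 := tendsto_pow_const_mul_const_pow_of_abs_lt_one 2 (r := exp (-(9 / 200))) (by
      rw [abs_of_pos (by positivity), exp_lt_one_iff]; norm_num)
  obtain ⟨K, hK⟩ := (h1.add (h2.const_mul 2)).bddAbove_range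
  refine ⟨max K 0, le_max_right _ _, fun n _ v hv => ?_⟩
  refine le_trans ?_ ((hK ⟨n, rfl⟩).trans (le_max_left _ _))
  refine (mul_le_mul_of_nonneg_left (measureReal_variance_unifState_lt hv)
    (sq_nonneg (n : ℝ))).trans_eq ?_
  ring

end EmpiricalVariance

/-! ### Null sets -/

/-- Integrate out coordinate `i` first: every fibre has at most one point, hence is null for the
atomless `m`. -/
lemma measure_pi_eq_zero_of_subsingleton {ι : Type*} [Fintype ι] [DecidableEq ι] {m : Measure ℝ}
    [SigmaFinite m] [NullSingletonClass m] {S : Set (ι → ℝ)} (hS : MeasurableSet S) (i : ι)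
    (h : ∀ w, {x | Function.update w i x ∈ S}.Subsingleton) :
    Measure.pi (fun _ : ι => m) S = 0 := by
  rw [← lintegral_indicator_one hS, ← nonpos_iff_eq_zero]
  refine (lintegral_le_of_lmarginal_le (μ := fun _ => m) {i} (g := fun _ => 0)
    (measurable_one.indicator hS) measurable_const fun w => ?_).trans_eq lintegral_zero
  rw [lmarginal_singleton]
  have hmeas : MeasurableSet {x | Function.update w i x ∈ S} :=
    (measurable_update w) hS
  change ∫⁻ x, {x | Function.update w i x ∈ S}.indicator 1 x ∂m ≤ _
  rw [lintegral_indicator_one hmeas, (h w).measure_zero]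
  exact zero_le

/-! ### Almost sure well-definedness -/

section WellDefined

variable {n : ℕ} {G : SimpleGraph (Fin n)} [DecidableRel G.Adj]

/-- For `lam < 1` the logarithm is strictly decreasing; for `lam = 1` it is constant and the linear
term is strict. -/
lemma strictMono_mul_sub_log_exp_add {lam B : ℝ} (h0 : 0 ≤ lam) (h1 : lam ≤ 1) (hB : 0 ≤ B) :
    StrictMono fun x => lam * x - log (exp (-(1 - lam) * x) + B) := by
  intro x y hxy
  have hpos : ∀ z, 0 < exp (-(1 - lam) * z) + B := fun z => add_pos_of_pos_of_nonneg (exp_pos _) hB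
  rcases h1.eq_or_lt with rfl | h1
  · simpa using hxy
  · have hlog : log (exp (-(1 - lam) * y) + B) < log (exp (-(1 - lam) * x) + B) := by
      refine log_lt_log (hpos y) (add_lt_add_left (exp_lt_exp.2 ?_) B)
      nlinarith
    have := mul_le_mul_of_nonneg_left hxy.le h0
    change lam * x - _ < lam * y - _
    linarith

lemma sum_exp_update_of_notMem {s : Finset (Fin n)} {i : Fin n} (hi : i ∉ s) (ε : ℝ)
    (w : Fin n → ℝ) (x : ℝ) :
    ∑ j ∈ s, exp (-ε * Function.update w i x j) = ∑ j ∈ s, exp (-ε * w j) :=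
  Finset.sum_congr rfl fun j hj => by
    rw [Function.update_of_ne (ne_of_mem_of_not_mem hj hi)]

/-- Adjacent vertices almost surely have different exit rates. -/
lemma ae_logExit_ne {lam : ℝ} (h0 : 0 ≤ lam) (h1 : lam ≤ 1) {v : NNReal} (hv : v ≠ 0)
    {i k : Fin n} (hik : G.Adj i k) :
    ∀ᵐ w ∂(Measure.pi fun _ : Fin n => gaussianReal 0 v),
      lam * w i + logNbrSum G (1 - lam) w i ≠ lam * w k + logNbrSum G (1 - lam) w k := by
  have := nullSingletonClass_gaussianReal (μ := 0) hv
  rw [ae_iff]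
  simp only [ne_eq, not_not]
  refine measure_pi_eq_zero_of_subsingleton (measurableSet_eq_fun (by fun_prop) (by fun_prop)) i
    fun w => ?_
  have hmem : i ∈ G.neighborFinset k := by simpa using hik.symm
  -- With only `w i` varying, the sum at `i` is fixed and the sum at `k` changes in one term, so
  -- equality reads "strictly monotone function of `x` equals a constant".
  have key : ∀ x, Function.update w i x ∈ {w : Fin n → ℝ | lam * w i + logNbrSum G (1 - lam) w i
      = lam * w k + logNbrSum G (1 - lam) w k} → lam * x - log (exp (-(1 - lam) * x)
        + ∑ j ∈ (G.neighborFinset k).erase i, exp (-(1 - lam) * w j))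
      = lam * w k - logNbrSum G (1 - lam) w i := by
    intro x hx
    have hx' : lam * Function.update w i x i + logNbrSum G (1 - lam) (Function.update w i x) i
      = lam * Function.update w i x k + logNbrSum G (1 - lam) (Function.update w i x) k := hx
    rw [Function.update_self, Function.update_of_ne hik.ne', logNbrSum, logNbrSum,
      sum_exp_update_of_notMem (by simp), ← Finset.add_sum_erase _ _ hmem, Function.update_self,
      sum_exp_update_of_notMem (Finset.notMem_erase i _)] at hx'
    rw [logNbrSum]
    linarith
  intro x hx y hy
  exact (strictMono_mul_sub_log_exp_add h0 h1 (Finset.sum_nonneg fun _ _ => (exp_pos _).le)).injective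
    ((key x hx).trans (key y hy).symm)

lemma ae_eval_ne {v : NNReal} (hv : v ≠ 0) {i k : Fin n} (hik : i ≠ k) :
    ∀ᵐ w ∂(Measure.pi fun _ : Fin n => gaussianReal 0 v), w i ≠ w k := by
  have := nullSingletonClass_gaussianReal (μ := 0) hv
  rw [ae_iff]
  simp only [ne_eq, not_not]
  refine measure_pi_eq_zero_of_subsingleton (measurableSet_eq_fun (by fun_prop) (by fun_prop)) i
    fun w => ?_
  have key : ∀ x, Function.update w i x ∈ {w : Fin n → ℝ | w i = w k} → x = w k := by
    intro x hx
    have hx' : Function.update w i x i = Function.update w i x k := hx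
    rwa [Function.update_self, Function.update_of_ne hik.symm] at hx'
  intro x hx y hy
  exact (key x hx).trans (key y hy).symm

lemma ae_variance_unifState_pos [NeZero n] (hn : 2 ≤ n) {v : NNReal} (hv : v ≠ 0) :
    ∀ᵐ w ∂(Measure.pi fun _ : Fin n => gaussianReal 0 v), 0 < Var[w; unifState n] := by
  have hik : (⟨0, by omega⟩ : Fin n) ≠ ⟨1, by omega⟩ := by simp
  filter_upwards [ae_eval_ne hv hik] with w hw using variance_unifState_pos hw

lemma ae_rhoWellDefined_remRates [NeZero n] (hG : G.Connected) (hn : 2 ≤ n) {lam : ℝ}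
    (h0 : 0 ≤ lam) (h1 : lam ≤ 1) {v : NNReal} (hv : v ≠ 0) :
    ∀ᵐ w ∂(Measure.pi fun _ : Fin n => gaussianReal 0 v), RhoWellDefined (remRates G lam w) := by
  obtain ⟨k, hk⟩ := neighborFinset_nonempty hG hn 0
  have hk' : G.Adj 0 k := by simpa using hk
  filter_upwards [ae_variance_unifState_pos hn hv, ae_logExit_ne h0 h1 hv hk'] with w hw hw'
  refine ⟨⟨_, (isStationaryDist_remRates_iff hG lam w _).2 rfl,
    fun p hp => (isStationaryDist_remRates_iff hG lam w p).1 hp⟩, fun i => ?_, fun i => ?_, ?_, ?_⟩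
  · rw [stationaryDist_remRates hG]
    exact div_pos (exp_pos _) (Finset.sum_pos (fun k _ => exp_pos _) Finset.univ_nonempty)
  · rw [exitRate_remRates]
    exact mul_pos (exp_pos _) (sum_exp_neighborFinset_pos hG hn _ w i)
  · rwa [effPotential_remRates hG, variance_add_const (memLp_unifState w).aestronglyMeasurable]
  · rw [logExit_remRates hG hn]
    exact variance_unifState_pos hw'

lemma measurable_variance_unifState [NeZero n] :
    Measurable fun w : Fin n → ℝ => Var[w; unifState n] := by
  simp_rw [variance_unifState]
  fun_prop

lemma measurable_rho_remRates [NeZero n] (hG : G.Connected) (hn : 2 ≤ n) (lam : ℝ) :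
    Measurable fun w => rho (remRates G lam w) := by
  simp_rw [rho_remRates hG hn, variance_unifState, covariance, integral_unifState]
  fun_prop

lemma integrable_rho_remRates [NeZero n] (hG : G.Connected) (hn : 2 ≤ n) (lam : ℝ)
    (μ : Measure (Fin n → ℝ)) [IsFiniteMeasure μ] :
    Integrable (fun w => rho (remRates G lam w)) μ :=
  Integrable.of_bound (C := 1) (measurable_rho_remRates hG hn lam).aestronglyMeasurable
    (ae_of_all _ fun w => abs_rho_remRates_le hG hn lam w)

end WellDefined

/-! ### The expected correlation -/

section Expectation

variable {n : ℕ} [NeZero n] {G : SimpleGraph (Fin n)} [DecidableRel G.Adj]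

/-- Where `Var w ≥ s / 2`, the denominator is replaced by this lower bound. Elsewhere `Var w`
cancels against the range bound `variance_logNbrSum_le`, so an arbitrarily small denominator does no
harm. -/
lemma one_sub_rho_remRates_le_add_indicator (hG : G.Connected) (hn : 2 ≤ n) {d : ℕ}
    (hd : G.IsRegularOfDegree d) {lam : ℝ} (h0 : 0 < lam) (h1 : lam ≤ 1) {s : ℝ} (hs : 0 < s)
    {w : Fin n → ℝ} (hw : 0 < Var[w; unifState n]) :
    1 - rho (remRates G lam w)
      ≤ 4 / (lam ^ 2 * s) * Var[logNbrSum G (1 - lam) w; unifState n]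
        + {w : Fin n → ℝ | Var[w; unifState n] < s / 2}.indicator
          (fun _ => n * (1 - lam) ^ 2 / lam ^ 2) w := by
  have hL := variance_nonneg (logNbrSum G (1 - lam) w) (unifState n)
  refine (one_sub_rho_remRates_le hG hn h0 hw).trans ?_
  by_cases hbad : Var[w; unifState n] < s / 2
  · rw [Set.indicator_of_mem (show w ∈ {w : Fin n → ℝ | Var[w; unifState n] < s / 2} from hbad)]
    refine le_add_of_nonneg_of_le (by positivity) ?_
    rw [div_le_div_iff₀ (by positivity) (by positivity)]
    have := variance_logNbrSum_le hG hn hd (sub_nonneg.2 h1) w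
    nlinarith [sq_nonneg lam]
  · rw [Set.indicator_of_notMem (show w ∉ {w : Fin n → ℝ | Var[w; unifState n] < s / 2} from hbad),
      add_zero]
    rw [not_lt] at hbad
    calc _ ≤ 2 * Var[logNbrSum G (1 - lam) w; unifState n] / (lam ^ 2 * (s / 2)) := by gcongr
      _ = _ := by field_simp; ring

lemma one_sub_integral_rho_remRates_le (hG : G.Connected) (hn : 2 ≤ n) {d : ℕ}
    (hd : G.IsRegularOfDegree d) {lam : ℝ} (h0 : 0 < lam) (h1 : lam ≤ 1) {v : NNReal}
    (hv : v ≠ 0) :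
    1 - ∫ w, rho (remRates G lam w) ∂(Measure.pi fun _ : Fin n => gaussianReal 0 v)
      ≤ (1 - lam) ^ 2 / lam ^ 2 * (π ^ 2 / 2
        + n * (Measure.pi fun _ : Fin n => gaussianReal 0 v).real
          {w | Var[w; unifState n] < v / 2}) := by
  have hv' : (0 : ℝ) < v := NNReal.coe_pos.2 (pos_iff_ne_zero.2 hv)
  set μ := Measure.pi fun _ : Fin n => gaussianReal 0 v
  have hS : MeasurableSet {w : Fin n → ℝ | Var[w; unifState n] < v / 2} :=
    measurableSet_lt measurable_variance_unifState measurable_const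
  have hI1 := (integrable_variance_logNbrSum hG hn hd (sub_nonneg.2 h1) v).const_mul
    (4 / (lam ^ 2 * v))
  have hI2 : Integrable ({w : Fin n → ℝ | Var[w; unifState n] < v / 2}.indicator
      fun _ => n * (1 - lam) ^ 2 / lam ^ 2) μ := (integrable_const _).indicator hS
  have hrho := integrable_rho_remRates hG hn lam μ
  calc 1 - ∫ w, rho (remRates G lam w) ∂μ = ∫ w, (1 - rho (remRates G lam w)) ∂μ := by
        rw [integral_sub (integrable_const _) hrho]; simp
    _ ≤ ∫ w, (4 / (lam ^ 2 * v) * Var[logNbrSum G (1 - lam) w; unifState n]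
        + {w : Fin n → ℝ | Var[w; unifState n] < v / 2}.indicator
          (fun _ => n * (1 - lam) ^ 2 / lam ^ 2) w) ∂μ := by
        refine integral_mono_ae ((integrable_const _).sub hrho) (hI1.add hI2) ?_
        filter_upwards [ae_variance_unifState_pos hn hv] with w hw
        exact one_sub_rho_remRates_le_add_indicator hG hn hd h0 h1 hv' hw
    _ = 4 / (lam ^ 2 * v) * ∫ w, Var[logNbrSum G (1 - lam) w; unifState n] ∂μ
        + μ.real {w | Var[w; unifState n] < v / 2} * (n * (1 - lam) ^ 2 / lam ^ 2) := by
        rw [integral_add hI1 hI2, integral_const_mul, integral_indicator_const _ hS, smul_eq_mul]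
    _ ≤ 4 / (lam ^ 2 * v) * (π ^ 2 / 8 * (v * (1 - lam) ^ 2))
        + μ.real {w | Var[w; unifState n] < v / 2} * (n * (1 - lam) ^ 2 / lam ^ 2) := by
        gcongr
        exact integral_variance_logNbrSum_le hG hn hd (sub_nonneg.2 h1) v
    _ = _ := by field_simp; ring_nf

lemma le_integral_rho_remRates (hG : G.Connected) (hn : 2 ≤ n) {d : ℕ}
    (hd : G.IsRegularOfDegree d) {lam : ℝ} (h0 : 0 ≤ lam) (h1 : lam ≤ 1) {v : NNReal}
    (hv : v ≠ 0) {K : ℝ} (hK0 : 0 ≤ K)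
    (hK : (n : ℝ) ^ 2 * (Measure.pi fun _ : Fin n => gaussianReal 0 v).real
      {w | Var[w; unifState n] < v / 2} ≤ K) :
    1 - 16 * (1 + K / √n) * (1 - lam) ^ 2
      ≤ ∫ w, rho (remRates G lam w) ∂(Measure.pi fun _ : Fin n => gaussianReal 0 v) := by
  set μ := Measure.pi fun _ : Fin n => gaussianReal 0 v
  have hn1 : (1 : ℝ) ≤ n := Nat.one_le_cast.2 (NeZero.one_le)
  have hKn : 0 ≤ K / √n := by positivity
  -- At `1/8` the claimed lower bound is already at most `1 - 16/8 = -1`. Below it, `lam² ≥ 5/12`,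
  -- so the main term is at most `12/5 * 5 = 12 ≤ 16` times `(1 - lam)²`.
  rcases le_or_gt (1 / 8) ((1 - lam) ^ 2) with h | h
  · have hrho : -1 ≤ ∫ w, rho (remRates G lam w) ∂μ := by
      have := integral_mono (integrable_const (-1)) (integrable_rho_remRates hG hn lam μ)
        fun w => (abs_le.1 (abs_rho_remRates_le hG hn lam w)).1
      simpa using this
    nlinarith [mul_nonneg hKn (sq_nonneg (1 - lam))]
  · have hlam : 129 / 200 ≤ lam := by nlinarith
    have hlam2 : 5 / 12 ≤ lam ^ 2 := by nlinarith
    have hmain := one_sub_integral_rho_remRates_le hG hn hd (by linarith) h1 hv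
    have htail : n * μ.real {w | Var[w; unifState n] < v / 2} ≤ K / √n := by
      have hsqrt : √(n : ℝ) ≤ n := sqrt_le_iff.2 ⟨by positivity, by nlinarith⟩
      rw [le_div_iff₀ (by positivity)]
      refine le_trans ?_ hK
      rw [pow_two, mul_right_comm]
      gcongr
    have hpi : π ^ 2 / 2 ≤ 5 := by nlinarith [pi_lt_d2, pi_pos]
    have hfrac : (1 - lam) ^ 2 / lam ^ 2 ≤ 12 / 5 * (1 - lam) ^ 2 := by
      rw [div_le_iff₀ (by positivity)]
      nlinarith [sq_nonneg (1 - lam)]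
    have hfinal : (1 - lam) ^ 2 / lam ^ 2 * (π ^ 2 / 2
        + n * μ.real {w | Var[w; unifState n] < v / 2})
        ≤ 12 / 5 * (1 - lam) ^ 2 * (5 + K / √n) := by
      gcongr
    nlinarith [mul_nonneg hKn (sq_nonneg (1 - lam)), sq_nonneg (1 - lam)]

end Expectation

theorem theorem2 :
    ∃ C : ℝ, ∀ (n : ℕ), 6 ≤ n →
      ∀ (G : SimpleGraph (Fin n)) [DecidableRel G.Adj] (d : ℕ),
        G.Connected → G.IsRegularOfDegree d →
      ∀ (σ : ℝ), 0 < σ → ∀ (lam : ℝ), lam ∈ Set.Icc (0 : ℝ) 1 →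
      ∀ (Ω : Type*) [MeasurableSpace Ω] (μ : Measure Ω) [IsProbabilityMeasure μ]
        (W : Ω → Fin n → ℝ),
        iIndepFun (fun i ω => W ω i) μ →
        (∀ i, HasLaw (fun ω => W ω i) (gaussianReal 0 (Real.toNNReal (σ ^ 2))) μ) →
        (∀ᵐ ω ∂μ, RhoWellDefined (remRates G lam (W ω))) ∧
        Integrable (fun ω => rho (remRates G lam (W ω))) μ ∧
        1 - 16 * (1 + C / √(n : ℝ)) * (1 - lam) ^ 2
          ≤ ∫ ω, rho (remRates G lam (W ω)) ∂μ := by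
  obtain ⟨K, hK0, hK⟩ := exists_sq_mul_measureReal_variance_unifState_lt_le
  refine ⟨K, fun n hn G _ d hG hd σ hσ lam hlam Ω _ μ _ W hind hlaw => ?_⟩
  have : NeZero n := ⟨by omega⟩
  have hn2 : 2 ≤ n := by omega
  set v := Real.toNNReal (σ ^ 2)
  have hv : v ≠ 0 := (Real.toNNReal_pos.2 (by positivity)).ne'
  have hW : AEMeasurable W μ := aemeasurable_pi_lambda _ fun i => (hlaw i).aemeasurable
  -- All three claims depend only on the law of `W`, so they transfer from the product Gaussian
  -- measure.
  have hmap : μ.map W = Measure.pi fun _ : Fin n => gaussianReal 0 v := by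
    have h := hind.map_fun_eq_pi_map fun i => (hlaw i).aemeasurable
    simp_rw [fun i => (hlaw i).map_eq] at h
    exact h
  refine ⟨ae_of_ae_map (p := fun w => RhoWellDefined (remRates G lam w)) hW ?_, ?_, ?_⟩
  · rw [hmap]
    exact ae_rhoWellDefined_remRates hG hn2 hlam.1 hlam.2 hv
  · exact (integrable_rho_remRates hG hn2 lam (μ.map W)).comp_aemeasurable hW
  · rw [← integral_map hW (measurable_rho_remRates hG hn2 lam).aestronglyMeasurable, hmap]
    exact le_integral_rho_remRates hG hn2 hd hlam.1 hlam.2 hv hK0 (hK n v hv)
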